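/- **Theorem 1.1.** Let $\Gamma$ be a finite simplicial graph with vertex set $V$ and edge set $E$, let $m : E \to \mathbb{N}_{\ge 2}$ be a labeling, and let $A = A[\Gamma]$ be the Artin group of $\Gamma$, that is, the group with one generator $\sigma_x$ for each $x \in V$ and, for each edge $e = \{x,y\} \in E$, the relation $$\underbrace{\sigma_x\sigma_y\sigma_x\cdots}_{m(e)\text{ factors}} = \underbrace{\sigma_y\sigma_x\sigma_y\cdots}_{m(e)\text{ factors}}.$$ For $X \subset V$ let $A_X$ be the subgroup of $A$ generated by $\{\sigma_x \mid x \in X\}$. A subgroup of $A$ is called *parabolic* if it is of the form $\beta A_X \beta^{-1}$ with $X \subset V$ and $\beta \in A$. 1. Let $X, Y \subset V$ and $\alpha \in A$ be such that $\alpha A_Y \alpha^{-1} \subset A_X$. Then there exist $Y' \subset X$ and $\gamma \in A_X$ such that $\alpha A_Y \alpha^{-1} = \gamma A_{Y'} \gamma^{-1}$. 2. Equivalently, a parabolic subgroup of $A$ that is contained in another parabolic subgroup is a parabolic subgroup of it: if $P$ is a parabolic subgroup of $A$ and $P \subset P' = \beta A_X \beta^{-1}$ with $X \subset V$ and $\beta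 \in A$, then there exist $Y' \subset X$ and $\gamma \in P'$ such that $P = \gamma\,(\beta A_{Y'} \beta^{-1})\,\gamma^{-1}$. -/

import Mathlib

/-- The alternating product `a * b * a * ⋯` with `n` factors, starting with `a`. -/
def alternatingProd {G : Type*} [Monoid G] (a b : G) : ℕ → G
  | 0 => 1
  | n + 1 => a * alternatingProd b a n

/-- The defining relators of the Artin group of the graph `Γ` with edge labels `m`:
for every edge `e = {x, y}`, the alternating products of `x, y` and of `y, x` with `m e` factors
are equal. -/
def artinRelators {V : Type*} (Γ : SimpleGraph V) (m : Γ.edgeSet → {n : ℕ // 2 ≤ n}) :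
    Set (FreeGroup V) :=
  {r | ∃ (x y : V) (h : Γ.Adj x y),
    r = alternatingProd (FreeGroup.of x) (FreeGroup.of y) (m ⟨s(x, y), h⟩ : ℕ) *
      (alternatingProd (FreeGroup.of y) (FreeGroup.of x) (m ⟨s(x, y), h⟩ : ℕ))⁻¹}

/-- The Artin group `A[Γ]` of a labelled graph. -/
abbrev ArtinGroup {V : Type*} (Γ : SimpleGraph V) (m : Γ.edgeSet → {n : ℕ // 2 ≤ n}) : Type _ :=
  PresentedGroup (artinRelators Γ m)

namespace ArtinGroup

/-- The standard generator `σ_x`. -/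
def sigma {V : Type*} (Γ : SimpleGraph V) (m : Γ.edgeSet → {n : ℕ // 2 ≤ n}) (x : V) :
    ArtinGroup Γ m :=
  PresentedGroup.of x

/-- The standard parabolic subgroup `A_X`, generated by the `σ_x` with `x ∈ X`. -/
def standardParabolic {V : Type*} (Γ : SimpleGraph V) (m : Γ.edgeSet → {n : ℕ // 2 ≤ n})
    (X : Set V) : Subgroup (ArtinGroup Γ m) :=
  Subgroup.closure (sigma Γ m '' X)

/-- The conjugate `g H g⁻¹` of a subgroup `H`. -/
def conjSubgroup {G : Type*} [Group G] (g : G) (H : Subgroup G) : Subgroup G :=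
  H.map (MulAut.conj g).toMonoidHom

/-- A parabolic subgroup is a conjugate of a standard parabolic subgroup. -/
def IsParabolic {V : Type*} (Γ : SimpleGraph V) (m : Γ.edgeSet → {n : ℕ // 2 ≤ n})
    (P : Subgroup (ArtinGroup Γ m)) : Prop :=
  ∃ (X : Set V) (g : ArtinGroup Γ m), P = conjSubgroup g (standardParabolic Γ m X)

/-- `P` is a parabolic subgroup of the parabolic subgroup `P' = β A_X β⁻¹`, regarded as an Artin
group with standard generators `β σ_x β⁻¹`, `x ∈ X`: for some `Y' ⊆ X`, the subgroup `P` is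
conjugate, by an element of `P'`, to the subgroup `β A_{Y'} β⁻¹`. -/
def IsParabolicIn {V : Type*} (Γ : SimpleGraph V) (m : Γ.edgeSet → {n : ℕ // 2 ≤ n})
    (β : ArtinGroup Γ m) (X : Set V) (P : Subgroup (ArtinGroup Γ m)) : Prop :=
  ∃ Y' : Set V, Y' ⊆ X ∧ ∃ γ ∈ conjSubgroup β (standardParabolic Γ m X),
    P = conjSubgroup γ (conjSubgroup β (standardParabolic Γ m Y'))

end ArtinGroup

/-! Let W be the Coxeter group of Γ, and call u ∈ W minimal if it has no right descent in X. By
Deodhar's lemma (`simple_mul_mem_minimalReps`), for u minimal and s a simple reflection, either su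
is minimal or su = uz with z ∈ X. Let σ_s send a pair (u, a), with u minimal and a ∈ A_X, to (su, a)
unless su = uz, and to (u, σ_z a) in that case. This defines an action of A that commutes with right
multiplication by A_X on the second component, and in which g ∈ A_X sends (1, b) to (1, gb).

Now let αA_Yα⁻¹ ⊂ A_X and α⁻¹·(1, 1) = (u, a). For y ∈ Y put β = ασ_yα⁻¹ ∈ A_X. From σ_yα⁻¹ = α⁻¹β
follows σ_y·(u, a) = (u, aβ). As yu ≠ u, the second rule applied, so σ_z a = aβ and β = a⁻¹σ_z a for
some z ∈ X. The element a does not depend on y, so γ = a⁻¹ works.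

The work lies in the braid relations (`alternatingProd_cocyclePerm`). If s and t both fix the coset
of u, with su = ux and tu = uy, then M x y = M s t and the relation is the one between σ_x and σ_y.
Otherwise a single x ∈ X is responsible for every fixed coset met in the orbit of u under ⟨s, t⟩
(`eq_of_fixed_in_dihedral_orbit`). Each side then contributes a power of σ_x, whose exponent counts
a reflection in the inversion sequence of the word; the two braid words have the same inversions
(`leftInvSeq_braidWord_perm`). The facts about W come from the geometric representation, where every
root is positive or negative. -/

namespace CoxeterMatrix

/-! ### Dihedral groups: orders of rotations and signs of coefficients. -/

open Polynomial.Chebyshev in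
/-- The product of two reflections that generate a dihedral group of angle `π / m` has order
dividing `m`. -/
theorem reflection_mul_reflection_pow_eq_one {E : Type*} [AddCommGroup E] [Module ℝ E]
    {x y : E} {f g : Module.Dual ℝ E} (hf : f x = 2) (hg : g y = 2) {m : ℕ} (hm : 2 ≤ m)
    (hfy : f y = -2 * Real.cos (Real.pi / m)) (hgx : g x = -2 * Real.cos (Real.pi / m)) :
    (Module.reflection hf * Module.reflection hg) ^ m = 1 := by
  have hm0 : (0 : ℝ) < m := by positivity
  -- For m = 2 the angle θ used below would be π, with zero sine, so this case is computed directly.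
  obtain rfl | hm3 := hm.eq_or_lt
  · have hfy0 : f y = 0 := by simp [hfy]
    have hgx0 : g x = 0 := by simp [hgx]
    ext z
    simp only [pow_two, LinearEquiv.mul_apply, Module.reflection_apply, map_sub, map_smul, hf, hg,
      hfy0, hgx0, LinearEquiv.coe_one, id]
    module
  set θ : ℝ := 2 * Real.pi / m with hθ
  have ht : f y * g x - 2 = 2 * Real.cos θ := by
    rw [hfy, hgx, hθ, mul_div_assoc, Real.cos_two_mul]; ring
  have hsin : Real.sin θ ≠ 0 := by
    refine (Real.sin_pos_of_pos_of_lt_pi (by positivity) ?_).ne'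
    rw [hθ, div_lt_iff₀ hm0]
    have : (3 : ℝ) ≤ m := by exact_mod_cast hm3
    nlinarith [Real.pi_pos]
  have hS (n : ℤ) : (S ℝ n).eval (2 * Real.cos θ) = Real.sin ((n + 1) * θ) / Real.sin θ := by
    rw [eq_div_iff hsin, S_two_mul_real_cos]
  ext z
  rw [Module.reflection_mul_reflection_pow_apply hf hg m z _ ht.symm]
  obtain ⟨k, hk⟩ := Nat.even_or_odd' m
  rcases hk with hk | hk
  · have e1 : ((m : ℤ) - 2) / 2 = k - 1 := by omega
    have e2 : ((m : ℤ) - 1) / 2 = k - 1 := by omega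
    have h0 : (S ℝ ((k : ℤ) - 1)).eval (2 * Real.cos θ) = 0 := by
      rw [hS]
      have : ((((k : ℤ) - 1 : ℤ) : ℝ) + 1) * θ = Real.pi := by
        rw [hθ]; push_cast; rw [hk]; push_cast
        have : (k : ℝ) ≠ 0 := by
          have : k ≠ 0 := by omega
          exact_mod_cast this
        field_simp; ring
      rw [this]; simp
    rw [e1, e2, h0]; simp
  · have e1 : ((m : ℤ) - 2) / 2 = k - 1 := by omega
    have e2 : ((m : ℤ) - 1) / 2 = k := by omega
    have e3 : ((m : ℤ) - 3) / 2 = k - 1 := by omega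
    have e4 : (m : ℤ) / 2 = k := by omega
    -- The angles kθ and (k + 1)θ add up to 2π, so their sines cancel.
    have h0 : (S ℝ (k : ℤ)).eval (2 * Real.cos θ) +
        (S ℝ ((k : ℤ) - 1)).eval (2 * Real.cos θ) = 0 := by
      rw [hS, hS, ← add_div, div_eq_zero_iff]
      left
      have e : ((((k : ℤ) - 1 : ℤ) : ℝ) + 1) * θ = 2 * Real.pi - (((k : ℤ) : ℝ) + 1) * θ := by
        rw [hθ]; push_cast; rw [hk]; push_cast
        field_simp; ring
      rw [e, Real.sin_two_pi_sub]; ring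
    rw [e1, e2, e3, e4, h0]; simp

/-- The nonnegative coefficients of the roots of a dihedral group. -/
theorem exists_dihedral_coeff {m : ℕ} (hm : m ≠ 1) :
    ∃ a : ℕ → ℝ, a 0 = 0 ∧ a 1 = 1 ∧
      (∀ k, a (k + 2) = 2 * Real.cos (Real.pi / m) * a (k + 1) - a k) ∧
      ∀ k, (m = 0 ∨ k ≤ m) → 0 ≤ a k := by
  rcases Nat.eq_zero_or_pos m with rfl | hm0
  · refine ⟨fun k => k, by simp, by simp, fun k => ?_, fun k _ => by positivity⟩
    simp; ring
  have hm2 : (2 : ℝ) ≤ m := by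
    have : 2 ≤ m := by omega
    exact_mod_cast this
  set θ : ℝ := Real.pi / m with hθ
  have hmθ : m * θ = Real.pi := by rw [hθ]; field_simp
  have hθ0 : 0 < θ := by positivity
  have hsin : 0 < Real.sin θ :=
    Real.sin_pos_of_pos_of_lt_pi hθ0 (by nlinarith)
  refine ⟨fun k => Real.sin (k * θ) / Real.sin θ, by simp, by simp [hsin.ne'], fun k => ?_,
    fun k hk => ?_⟩
  · have h1 : ((k + 2 : ℕ) : ℝ) * θ = ((k + 1 : ℕ) : ℝ) * θ + θ := by push_cast; ring
    have h2 : (k : ℝ) * θ = ((k + 1 : ℕ) : ℝ) * θ - θ := by push_cast; ring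
    simp only [h1, h2, Real.sin_add, Real.sin_sub]
    field_simp; ring
  · have hk' : (k : ℝ) ≤ m := by
      have : k ≤ m := by omega
      exact_mod_cast this
    refine div_nonneg (Real.sin_nonneg_of_nonneg_of_le_pi (by positivity) ?_) hsin.le
    rw [← hmθ]; gcongr

/-! ### The geometric representation. -/

variable {B : Type*} [DecidableEq B] (M : CoxeterMatrix B)

/-- The simple roots. -/
def simpleRoot (i : B) : B → ℝ := Pi.single i 1

theorem simpleRoot_self (i : B) : simpleRoot i i = 1 := by simp [simpleRoot]

theorem simpleRoot_of_ne {i j : B} (h : j ≠ i) : simpleRoot i j = 0 := by simp [simpleRoot, h]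

theorem simpleRoot_nonneg (i : B) : 0 ≤ simpleRoot i :=
  Pi.single_nonneg.2 zero_le_one

theorem simpleRoot_injective : Function.Injective (simpleRoot : B → B → ℝ) := by
  intro i j h
  by_contra hij
  have := congrFun h i
  rw [simpleRoot_self, simpleRoot_of_ne hij] at this
  exact one_ne_zero this

variable [Fintype B]

/-- The symmetric bilinear form of the geometric representation of a Coxeter group. -/
noncomputable def geomForm : LinearMap.BilinForm ℝ (B → ℝ) :=
  Matrix.toBilin' (Matrix.of fun i j => -Real.cos (Real.pi / M i j))

theorem geomForm_simpleRoot (i j : B) :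
    M.geomForm (simpleRoot i) (simpleRoot j) = -Real.cos (Real.pi / M i j) := by
  simp [geomForm, simpleRoot, Matrix.toBilin'_single]

theorem geomForm_simpleRoot_self (i : B) : M.geomForm (simpleRoot i) (simpleRoot i) = 1 := by
  simp [geomForm_simpleRoot]

theorem geomForm_comm (x y : B → ℝ) : M.geomForm x y = M.geomForm y x := by
  rw [geomForm, Matrix.toBilin'_apply', Matrix.toBilin'_apply', Matrix.dotProduct_mulVec,
    dotProduct_comm, ← Matrix.mulVec_transpose]
  congr 2
  ext i j
  simp [M.symmetric i j]

theorem two_geomForm_self (i : B) :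
    ((2 : ℝ) • M.geomForm (simpleRoot i)) (simpleRoot i) = 2 := by
  simp [geomForm_simpleRoot_self]

/-- The simple reflections of the geometric representation. -/
noncomputable def geomReflection (i : B) : (B → ℝ) ≃ₗ[ℝ] (B → ℝ) :=
  Module.reflection (M.two_geomForm_self i)

theorem geomReflection_apply (i : B) (v : B → ℝ) :
    M.geomReflection i v = v - (2 * M.geomForm (simpleRoot i) v) • simpleRoot i := by
  simp [geomReflection, Module.reflection_apply]

theorem geomReflection_apply_of_ne (i : B) (v : B → ℝ) {j : B} (h : j ≠ i) :
    M.geomReflection i v j = v j := by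
  simp [geomReflection_apply, simpleRoot_of_ne h]

theorem geomForm_geomReflection (i : B) (v w : B → ℝ) :
    M.geomForm (M.geomReflection i v) (M.geomReflection i w) = M.geomForm v w := by
  simp only [geomReflection_apply, map_sub, map_smul, LinearMap.sub_apply, LinearMap.smul_apply,
    geomForm_simpleRoot_self, smul_eq_mul, M.geomForm_comm v (simpleRoot i)]
  ring

theorem isLiftable_geomReflection : M.IsLiftable M.geomReflection := by
  intro i j
  by_cases h0 : M i j = 0
  · simp [h0]
  by_cases hij : i = j
  · subst hij
    rw [M.diagonal, pow_one]
    ext v : 1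
    exact congrFun (Module.involutive_reflection (M.two_geomForm_self i)).comp_self v
  have h1 := M.off_diagonal i j hij
  refine reflection_mul_reflection_pow_eq_one _ _ (by omega) ?_ ?_
  · simp [geomForm_simpleRoot]
  · simp [geomForm_simpleRoot, M.symmetric j i]

end CoxeterMatrix

/-! ### Positive and negative roots. -/

namespace CoxeterSystem

open CoxeterMatrix

variable {B W : Type*} [Group W] {M : CoxeterMatrix B} (cs : CoxeterSystem M W)

theorem wordProd_alternatingWord_add (i j : B) (n k : ℕ) :
    ∃ u, cs.length u ≤ k ∧ cs.wordProd (alternatingWord i j (k + n)) =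
      u * cs.wordProd (alternatingWord i j n) := by
  induction k with
  | zero => exact ⟨1, by simp, by simp⟩
  | succ k ih =>
    obtain ⟨u, hu, h⟩ := ih
    rw [show k + 1 + n = (k + n) + 1 by ring, alternatingWord_succ', wordProd_cons, h]
    refine ⟨cs.simple _ * u, (cs.length_mul_le _ _).trans ?_, (mul_assoc _ _ _).symm⟩
    rw [length_simple]; omega

/-- A reduced factorization that ends in a longest alternating word cannot be too long unless the
other letter is a right descent. -/
theorem length_mul_simple_lt_of_alternatingWord {i j : B} {w v : W} {k : ℕ} (hM : M i j ≠ 0)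
    (hk : M i j ≤ k) (hw : w = v * cs.wordProd (alternatingWord i j k))
    (hl : cs.length v + k = cs.length w) : cs.length (w * cs.simple i) < cs.length w := by
  obtain ⟨n, rfl⟩ : ∃ n, k = n + M i j := ⟨k - M i j, by omega⟩
  obtain ⟨u, hu, h⟩ := cs.wordProd_alternatingWord_add i j (M i j) n
  obtain ⟨p, hp⟩ := Nat.exists_eq_succ_of_ne_zero hM
  have hb := cs.wordProd_braidWord_eq i j
  rw [braidWord, braidWord, M.symmetric j i] at hb
  -- The longest alternating word ends in j; the braid relation makes it end in i, and that letter
  -- cancels.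
  have e : w * cs.simple i = v * u * cs.wordProd (alternatingWord i j p) := by
    rw [hw, h, hb, hp, Nat.succ_eq_add_one, alternatingWord_succ, wordProd_concat]
    simp [mul_assoc]
  have l1 := cs.length_mul_le (v * u) (cs.wordProd (alternatingWord i j p))
  have l2 := cs.length_mul_le v u
  have l3 := cs.length_wordProd_le (alternatingWord i j p)
  rw [length_alternatingWord] at l3
  rw [e]; omega

variable [DecidableEq B]

theorem eq_smul_simpleRoot {v : B → ℝ} {j : B} (h : ∀ k, k ≠ j → v k = 0) :
    v = v j • simpleRoot j := by
  ext k
  by_cases hk : k = j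
  · subst hk; simp [simpleRoot_self]
  · simp [h k hk, simpleRoot_of_ne hk]

variable [Fintype B]

/-- The geometric representation of a Coxeter group. -/
noncomputable def geomRep : W →* ((B → ℝ) ≃ₗ[ℝ] (B → ℝ)) :=
  cs.lift ⟨M.geomReflection, M.isLiftable_geomReflection⟩

theorem geomRep_simple (i : B) : cs.geomRep (cs.simple i) = M.geomReflection i :=
  cs.lift_apply_simple M.isLiftable_geomReflection i

theorem geomRep_simple_simpleRoot (i : B) :
    cs.geomRep (cs.simple i) (simpleRoot i) = -simpleRoot i := by
  rw [geomRep_simple, geomReflection, Module.reflection_apply_self]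

theorem geomRep_mul_apply (u w : W) (v : B → ℝ) :
    cs.geomRep (u * w) v = cs.geomRep u (cs.geomRep w v) := by
  rw [map_mul, LinearEquiv.mul_apply]

theorem geomRep_inv_apply_self (w : W) (v : B → ℝ) :
    cs.geomRep w⁻¹ (cs.geomRep w v) = v := by
  rw [← geomRep_mul_apply, inv_mul_cancel, map_one, LinearEquiv.coe_one, id]

theorem geomRep_apply_inv_self (w : W) (v : B → ℝ) :
    cs.geomRep w (cs.geomRep w⁻¹ v) = v := by
  rw [← geomRep_mul_apply, mul_inv_cancel, map_one, LinearEquiv.coe_one, id]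

theorem geomForm_geomRep (w : W) (v v' : B → ℝ) :
    M.geomForm (cs.geomRep w v) (cs.geomRep w v') = M.geomForm v v' := by
  induction w using cs.simple_induction_left with
  | one => simp
  | mul_simple_left w i ih =>
    rw [geomRep_mul_apply, geomRep_mul_apply, geomRep_simple, geomForm_geomReflection, ih]

theorem geomRep_alternatingWord {i j : B} {a : ℕ → ℝ} (h0 : a 0 = 0) (h1 : a 1 = 1)
    (ha : ∀ k, a (k + 2) = 2 * Real.cos (Real.pi / M i j) * a (k + 1) - a k) (k : ℕ) :
    cs.geomRep (cs.wordProd (alternatingWord i j k)) (simpleRoot i) =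
      if Even k then a (k + 1) • simpleRoot i + a k • simpleRoot j
      else a (k + 1) • simpleRoot j + a k • simpleRoot i := by
  induction k with
  | zero => simp [alternatingWord, h0, h1]
  | succ k ih =>
    rw [alternatingWord_succ', wordProd_cons, geomRep_mul_apply, ih]
    by_cases hk : Even k
    · have hk' : ¬Even (k + 1) := by simpa [Nat.even_add_one] using hk
      rw [if_pos hk, if_pos hk, if_neg hk', geomRep_simple]
      simp only [map_add, map_smul, geomReflection_apply, geomForm_simpleRoot, M.symmetric j i,
        M.diagonal, ha k]
      simp
      module
    · have hk' : Even (k + 1) := by simpa [Nat.even_add_one] using hk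
      rw [if_neg hk, if_neg hk, if_pos hk', geomRep_simple]
      simp only [map_add, map_smul, geomReflection_apply, geomForm_simpleRoot,
        M.diagonal, ha k]
      simp
      module

/-- If `s i` is not a right descent of `w`, then `w` sends the simple root `i` to a positive
root. -/
theorem geomRep_simpleRoot_nonneg {w : W} {i : B} (h : ¬cs.IsRightDescent w i) :
    0 ≤ cs.geomRep w (simpleRoot i) := by
  induction hn : cs.length w using Nat.strong_induction_on generalizing w i with
  | _ n ih =>
  subst hn
  by_cases hw1 : w = 1
  · subst hw1; simpa using simpleRoot_nonneg i
  obtain ⟨j, hj⟩ := cs.exists_rightDescent_of_ne_one hw1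
  have hij : i ≠ j := by rintro rfl; exact h hj
  let P : ℕ → Prop := fun k =>
    ∃ v, w = v * cs.wordProd (alternatingWord i j k) ∧ cs.length v + k = cs.length w
  classical
  have hP1 : P 1 := by
    refine ⟨w * cs.simple j, by simp [alternatingWord], ?_⟩
    exact cs.isRightDescent_iff.1 hj
  have hpos : 1 ≤ cs.length w := by
    have := cs.isRightDescent_iff.1 hj; omega
  -- Split off the longest alternating tail ending in j. The remaining v has neither i nor j as a
  -- right descent: one would lengthen the tail, the other would cancel its first letter.
  set k := Nat.findGreatest P (cs.length w) with hk
  have hk1 : 1 ≤ k := Nat.le_findGreatest hpos hP1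
  obtain ⟨v, hwv, hl⟩ : P k := Nat.findGreatest_spec hpos hP1
  have hmax : ¬P (k + 1) := by
    intro hP
    obtain ⟨v', -, hl'⟩ := id hP
    exact Nat.findGreatest_is_greatest (Nat.lt_succ_self k) (by omega) hP
  have hlast : ¬cs.IsRightDescent v (if Even k then j else i) := by
    intro hd
    refine hmax ⟨v * cs.simple (if Even k then j else i), ?_, ?_⟩
    · rw [alternatingWord_succ', wordProd_cons, ← mul_assoc, simple_mul_simple_cancel_right, hwv]
    · have := cs.isRightDescent_iff.1 hd
      omega
  obtain ⟨p, hp⟩ : ∃ p, k = p + 1 := ⟨k - 1, by omega⟩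
  have hfirst : ¬cs.IsRightDescent v (if Even p then j else i) := by
    intro hd
    have e : w = v * cs.simple (if Even p then j else i) *
        cs.wordProd (alternatingWord i j p) := by
      rw [hwv, hp, alternatingWord_succ', wordProd_cons, mul_assoc]
    have l1 := cs.length_mul_le (v * cs.simple (if Even p then j else i))
      (cs.wordProd (alternatingWord i j p))
    rw [← e] at l1
    have l2 := cs.length_wordProd_le (alternatingWord i j p)
    rw [length_alternatingWord] at l2
    have := cs.isRightDescent_iff.1 hd
    omega
  have hboth : ¬cs.IsRightDescent v i ∧ ¬cs.IsRightDescent v j := by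
    have hpar : Even k ↔ ¬Even p := by rw [hp, Nat.even_add_one]
    by_cases hkp : Even p
    · have : ¬Even k := by tauto
      rw [if_pos hkp] at hfirst; rw [if_neg this] at hlast
      exact ⟨hlast, hfirst⟩
    · have : Even k := by tauto
      rw [if_neg hkp] at hfirst; rw [if_pos this] at hlast
      exact ⟨hfirst, hlast⟩
  have hvi := ih _ (by omega) hboth.1 rfl
  have hvj := ih _ (by omega) hboth.2 rfl
  -- This bound is what makes both coefficients a k and a (k + 1) nonnegative.
  have hkM : M i j = 0 ∨ k + 1 ≤ M i j := by
    by_contra! hcon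
    exact h (cs.length_mul_simple_lt_of_alternatingWord hcon.1 (by omega) hwv hl)
  obtain ⟨a, h0, h1, ha, hnn⟩ := exists_dihedral_coeff (M.off_diagonal i j hij)
  rw [hwv, geomRep_mul_apply, cs.geomRep_alternatingWord h0 h1 ha]
  have hak := hnn k (by omega)
  have hak1 := hnn (k + 1) hkM
  split_ifs
  · rw [map_add, map_smul, map_smul]
    exact add_nonneg (smul_nonneg hak1 hvi) (smul_nonneg hak hvj)
  · rw [map_add, map_smul, map_smul]
    exact add_nonneg (smul_nonneg hak1 hvj) (smul_nonneg hak hvi)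

/-- If `s i` is a right descent of `w`, then `w` sends the simple root `i` to a negative root. -/
theorem geomRep_simpleRoot_nonpos {w : W} {i : B} (h : cs.IsRightDescent w i) :
    cs.geomRep w (simpleRoot i) ≤ 0 := by
  have := cs.geomRep_simpleRoot_nonneg (cs.isRightDescent_iff_not_isRightDescent_mul.1 h)
  rw [geomRep_mul_apply, geomRep_simple_simpleRoot, map_neg] at this
  exact neg_nonneg.1 this

theorem geomRep_simpleRoot_ne_zero (w : W) (i : B) : cs.geomRep w (simpleRoot i) ≠ 0 := by
  intro h
  have := (cs.geomRep w).map_eq_zero_iff.1 h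
  have h1 := congrFun this i
  rw [simpleRoot_self] at h1
  exact one_ne_zero h1

theorem geomRep_simpleRoot_nonneg_iff {w : W} {i : B} :
    0 ≤ cs.geomRep w (simpleRoot i) ↔ ¬cs.IsRightDescent w i :=
  ⟨fun h h' => cs.geomRep_simpleRoot_ne_zero w i (le_antisymm (cs.geomRep_simpleRoot_nonpos h') h),
    cs.geomRep_simpleRoot_nonneg⟩

theorem geomRep_simpleRoot_nonneg_or_nonpos (w : W) (i : B) :
    0 ≤ cs.geomRep w (simpleRoot i) ∨ cs.geomRep w (simpleRoot i) ≤ 0 := by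
  by_cases h : cs.IsRightDescent w i
  · exact Or.inr (cs.geomRep_simpleRoot_nonpos h)
  · exact Or.inl (cs.geomRep_simpleRoot_nonneg h)

/-- A nontrivial w has a right descent, and makes that simple root negative. -/
theorem geomRep_injective : Function.Injective cs.geomRep := by
  rw [injective_iff_map_eq_one]
  intro w hw
  by_contra hne
  obtain ⟨i, hi⟩ := cs.exists_rightDescent_of_ne_one hne
  refine cs.geomRep_simpleRoot_nonneg_iff.1 ?_ hi
  rw [hw]
  exact simpleRoot_nonneg i

/-- A root that is a nonnegative multiple of a simple root is that simple root. -/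
theorem eq_simpleRoot_of_eq_smul {w : W} {i j : B} {c : ℝ} (hc : 0 ≤ c)
    (h : cs.geomRep w (simpleRoot i) = c • simpleRoot j) :
    cs.geomRep w (simpleRoot i) = simpleRoot j := by
  have h1 := cs.geomForm_geomRep w (simpleRoot i) (simpleRoot i)
  rw [h, geomForm_simpleRoot_self, map_smul, map_smul, LinearMap.smul_apply,
    geomForm_simpleRoot_self] at h1
  have : c = 1 := by
    simp only [smul_eq_mul, mul_one] at h1
    nlinarith
  rw [h, this, one_smul]

/-- A simple reflection permutes the positive roots different from the simple root. -/
theorem geomRep_simple_mul_nonneg {w : W} {i j : B} (h : 0 ≤ cs.geomRep w (simpleRoot i))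
    (hne : cs.geomRep w (simpleRoot i) ≠ simpleRoot j) :
    0 ≤ cs.geomRep (cs.simple j * w) (simpleRoot i) := by
  refine (cs.geomRep_simpleRoot_nonneg_or_nonpos _ _).resolve_right fun hneg => hne ?_
  refine cs.eq_simpleRoot_of_eq_smul (h j) (eq_smul_simpleRoot fun k hk => ?_)
  have h1 := hneg k
  rw [geomRep_mul_apply, geomRep_simple, geomReflection_apply_of_ne _ _ _ hk] at h1
  exact le_antisymm h1 (h k)

/-- An element that sends one simple root to another conjugates the simple reflections. -/
theorem conj_simple_of_geomRep_eq {w : W} {i j : B}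
    (h : cs.geomRep w (simpleRoot i) = simpleRoot j) :
    w * cs.simple i * w⁻¹ = cs.simple j := by
  apply cs.geomRep_injective
  ext v : 1
  rw [geomRep_mul_apply, geomRep_mul_apply, geomRep_simple, geomRep_simple, geomReflection_apply,
    geomReflection_apply, map_sub, map_smul, h, geomRep_apply_inv_self, ← h,
    ← cs.geomForm_geomRep w (simpleRoot i), geomRep_apply_inv_self]

/-- The image root is negated by s_j, which changes only the coordinate j; hence it is a multiple of
the simple root j, and the invariant form fixes the factor up to sign. -/
theorem geomRep_eq_or_eq_neg_of_conj_simple {w : W} {i j : B}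
    (h : w * cs.simple i * w⁻¹ = cs.simple j) :
    cs.geomRep w (simpleRoot i) = simpleRoot j ∨ cs.geomRep w (simpleRoot i) = -simpleRoot j := by
  have h1 : cs.geomRep (cs.simple j) (cs.geomRep w (simpleRoot i)) =
      -cs.geomRep w (simpleRoot i) := by
    rw [← h, geomRep_mul_apply, geomRep_mul_apply, geomRep_inv_apply_self,
      geomRep_simple_simpleRoot, map_neg]
  have h2 : ∀ k, k ≠ j → cs.geomRep w (simpleRoot i) k = 0 := by
    intro k hk
    have := congrFun h1 k
    rw [geomRep_simple, geomReflection_apply_of_ne _ _ _ hk, Pi.neg_apply] at this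
    linarith
  have h3 := eq_smul_simpleRoot h2
  rcases cs.geomRep_simpleRoot_nonneg_or_nonpos w i with hn | hn
  · exact Or.inl (cs.eq_simpleRoot_of_eq_smul (hn j) h3)
  · right
    have h4 : cs.geomRep (w * cs.simple i) (simpleRoot i) =
        (-cs.geomRep w (simpleRoot i) j) • simpleRoot j := by
      rw [geomRep_mul_apply, geomRep_simple_simpleRoot, map_neg, neg_smul, ← h3]
    have h5 := cs.eq_simpleRoot_of_eq_smul (neg_nonneg.2 (hn j)) h4
    rw [geomRep_mul_apply, geomRep_simple_simpleRoot, map_neg] at h5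
    rw [← h5, neg_neg]

end CoxeterSystem

/-! ### Inversion sequences and minimal coset representatives. -/

namespace CoxeterSystem

open CoxeterMatrix

section AlternatingWords

variable {B W : Type*} [Group W] {M : CoxeterMatrix B} (cs : CoxeterSystem M W)

theorem alternatingProd_eq_prod_map {G : Type*} [Monoid G] (f : B → G) (i j : B) (n : ℕ) :
    alternatingProd (f i) (f j) n = ((alternatingWord j i n).reverse.map f).prod := by
  induction n generalizing i j with
  | zero => simp [alternatingProd, alternatingWord]
  | succ n ih => simp [alternatingProd, alternatingWord_succ, ih j i]

theorem leftInvSeq_reverse_alternatingWord (i j : B) (n : ℕ) :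
    cs.leftInvSeq (alternatingWord j i n).reverse =
      (List.range n).map fun k => (cs.simple i * cs.simple j) ^ k * cs.simple i := by
  induction n generalizing i j with
  | zero => simp [alternatingWord]
  | succ n ih =>
    rw [alternatingWord_succ, List.concat_eq_append, List.reverse_append, List.reverse_singleton,
      List.singleton_append, leftInvSeq, ih j i, List.range_succ_eq_map]
    simp only [List.map_cons, List.map_map, pow_zero, one_mul, List.cons.injEq, true_and]
    refine List.map_congr_left fun k _ => ?_
    simp only [Function.comp_apply, MulAut.conj_apply, inv_simple, Nat.succ_eq_add_one]
    rw [mul_pow_mul]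
    simp only [mul_assoc]
    rw [← mul_assoc, ← mul_assoc, ← pow_succ', pow_succ]

/-- The reflections are (st)^k s for k < M and (ts)^k t for k < M. Since (st)^M = 1, one list is the
reverse of the other. -/
theorem leftInvSeq_braidWord_perm (i j : B) :
    (cs.leftInvSeq (alternatingWord j i (M i j)).reverse).Perm
      (cs.leftInvSeq (alternatingWord i j (M i j)).reverse) := by
  rw [leftInvSeq_reverse_alternatingWord, leftInvSeq_reverse_alternatingWord]
  refine (List.reverse_perm _).symm.trans (List.Perm.of_eq ?_)
  refine List.ext_getElem (by simp) fun k h1 h2 => ?_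
  simp only [List.length_map, List.length_range] at h2
  simp only [List.getElem_reverse, List.getElem_map, List.getElem_range, List.length_map,
    List.length_range]
  obtain ⟨p, hp⟩ : ∃ p, M i j = p + 1 + k := ⟨M i j - 1 - k, by omega⟩
  have h := cs.simple_mul_simple_pow i j
  have hinv : (cs.simple j * cs.simple i) = (cs.simple i * cs.simple j)⁻¹ := by simp
  rw [hp] at h
  rw [hp, show p + 1 + k - 1 - k = p by omega, hinv, inv_pow, eq_inv_mul_iff_mul_eq,
    ← mul_assoc, ← pow_add]
  have h3 : (cs.simple i * cs.simple j) ^ (k + p) * cs.simple i * cs.simple j = 1 := by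
    rw [mul_assoc, ← pow_succ, show k + p + 1 = p + 1 + k by ring, h]
  exact (eq_inv_of_mul_eq_one_left h3).trans (cs.inv_simple j)

theorem wordProd_reverse_braidWord_eq (i j : B) :
    cs.wordProd (alternatingWord j i (M i j)).reverse =
      cs.wordProd (alternatingWord i j (M i j)).reverse := by
  have := cs.wordProd_braidWord_eq i j
  rw [braidWord, braidWord, M.symmetric j i] at this
  rw [wordProd_reverse, wordProd_reverse, this]

/-- The minimal representatives of the left cosets of the parabolic subgroup generated by the
simple reflections in `X`. -/
def minimalReps (X : Set B) : Set W :=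
  {u | ∀ z ∈ X, ¬cs.IsRightDescent u z}

theorem one_mem_minimalReps (X : Set B) : (1 : W) ∈ cs.minimalReps X :=
  fun z _ => cs.not_isRightDescent_one z

theorem not_exists_simple_mul {X : Set B} {u : W} {s : B}
    (h : ¬∃ z ∈ X, cs.simple s * u = u * cs.simple z) :
    ¬∃ z ∈ X, cs.simple s * (cs.simple s * u) = cs.simple s * u * cs.simple z := by
  rintro ⟨z, hz, he⟩
  exact h ⟨z, hz, by rw [mul_assoc] at he; exact mul_left_cancel he⟩

theorem simple_mem_closure {r s t : B} (hr : r = s ∨ r = t) :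
    cs.simple r ∈ Subgroup.closure {cs.simple s, cs.simple t} := by
  apply Subgroup.subset_closure
  rcases hr with rfl | rfl <;> simp

end AlternatingWords

variable {B W : Type*} [Fintype B] [DecidableEq B] [Group W] {M : CoxeterMatrix B}
  (cs : CoxeterSystem M W)

theorem simple_injective : Function.Injective cs.simple := by
  intro i j h
  have := cs.geomRep_eq_or_eq_neg_of_conj_simple (w := 1) (i := i) (j := j) (by simpa using h)
  simp only [map_one, LinearEquiv.coe_one, id] at this
  refine simpleRoot_injective (this.resolve_right fun hn => ?_)
  have h1 := congrFun hn i
  have h2 := simpleRoot_nonneg j i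
  rw [simpleRoot_self, Pi.neg_apply] at h1
  simp only [Pi.zero_apply] at h2
  linarith

theorem simple_mul_eq_mul_simple_iff {u : W} {s z : B} (hz : ¬cs.IsRightDescent u z) :
    cs.simple s * u = u * cs.simple z ↔ cs.geomRep u (simpleRoot z) = simpleRoot s := by
  constructor
  · intro h
    have hconj : u * cs.simple z * u⁻¹ = cs.simple s := by rw [← h]; group
    refine (cs.geomRep_eq_or_eq_neg_of_conj_simple hconj).resolve_right fun hn => hz ?_
    by_contra hz'
    have h1 := cs.geomRep_simpleRoot_nonneg hz' s
    rw [hn, Pi.neg_apply, simpleRoot_self, Pi.zero_apply] at h1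
    linarith
  · intro h
    rw [← cs.conj_simple_of_geomRep_eq h]; group

theorem eq_of_simple_mul_eq {u : W} {s z z' : B} (h : cs.simple s * u = u * cs.simple z)
    (h' : cs.simple s * u = u * cs.simple z') : z = z' :=
  cs.simple_injective (mul_left_cancel (h.symm.trans h'))

/-- Deodhar's lemma: s keeps every positive root positive except its own simple root, so su can gain
a right descent z ∈ X only if u sends the root of z to that of s, that is, su = uz. -/
theorem simple_mul_mem_minimalReps {X : Set B} {u : W} (hu : u ∈ cs.minimalReps X) {s : B}
    (h : ¬∃ z ∈ X, cs.simple s * u = u * cs.simple z) : cs.simple s * u ∈ cs.minimalReps X := by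
  intro z hz
  rw [← cs.geomRep_simpleRoot_nonneg_iff]
  refine cs.geomRep_simple_mul_nonneg (cs.geomRep_simpleRoot_nonneg (hu z hz)) fun he => ?_
  exact h ⟨z, hz, (cs.simple_mul_eq_mul_simple_iff (hu z hz)).2 he⟩

/-! ### Dihedral orbits of cosets. -/

section Dihedral

variable {X : Set B} {s t : B}

theorem geomRep_apply_of_mem_closure {d : W} (hd : d ∈ Subgroup.closure {cs.simple s, cs.simple t})
    (v : B → ℝ) {k : B} (hs : k ≠ s) (ht : k ≠ t) : cs.geomRep d v k = v k := by
  induction hd using Subgroup.closure_induction generalizing v with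
  | mem x hx =>
    rcases hx with rfl | rfl
    · rw [geomRep_simple, geomReflection_apply_of_ne _ _ _ hs]
    · rw [geomRep_simple, geomReflection_apply_of_ne _ _ _ ht]
  | one => simp
  | mul x y _ _ hx hy => rw [geomRep_mul_apply, hx, hy]
  | inv x _ hx =>
    have := hx (cs.geomRep x⁻¹ v)
    rw [geomRep_apply_inv_self] at this
    exact this.symm

/-- If `u` is minimal for the dihedral group on the left and for `X` on the right, a conjugate of a
simple reflection of `X` by `u` that lies in the dihedral group up to conjugacy is one of the two
simple reflections. -/
theorem simple_mul_eq_or_of_minimal (hst : s ≠ t) {u d : W}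
    (hd : d ∈ Subgroup.closure {cs.simple s, cs.simple t})
    (hus : ¬cs.IsLeftDescent u s) (hut : ¬cs.IsLeftDescent u t) {r z : B} (hr : r = s ∨ r = t)
    (huz : ¬cs.IsRightDescent u z) (hduz : ¬cs.IsRightDescent (d * u) z)
    (h : cs.simple r * (d * u) = d * u * cs.simple z) :
    cs.simple s * u = u * cs.simple z ∨ cs.simple t * u = u * cs.simple z := by
  rw [cs.simple_mul_eq_mul_simple_iff hduz, geomRep_mul_apply] at h
  rw [cs.simple_mul_eq_mul_simple_iff huz, cs.simple_mul_eq_mul_simple_iff huz]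
  have hv0 := cs.geomRep_simpleRoot_nonneg huz
  set v := cs.geomRep u (simpleRoot z) with hv
  -- The element d changes only the coordinates s and t, and it sends v to the simple root of r.
  have hsupp : ∀ k, k ≠ s → k ≠ t → v k = 0 := by
    intro k hks hkt
    rw [← cs.geomRep_apply_of_mem_closure hd v hks hkt, h, simpleRoot_of_ne]
    rcases hr with rfl | rfl <;> assumption
  by_cases hvs : v s = 0
  · right
    refine cs.eq_simpleRoot_of_eq_smul (hv0 t) (eq_smul_simpleRoot fun k hk => ?_)
    by_cases hks : k = s
    · rw [hks]; exact hvs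
    · exact hsupp k hks hk
  by_cases hvt : v t = 0
  · left
    refine cs.eq_simpleRoot_of_eq_smul (hv0 s) (eq_smul_simpleRoot fun k hk => ?_)
    by_cases hkt : k = t
    · rw [hkt]; exact hvt
    · exact hsupp k hk hkt
  exfalso
  have hvs' : 0 < v s := lt_of_le_of_ne (hv0 s) (Ne.symm hvs)
  have hvt' : 0 < v t := lt_of_le_of_ne (hv0 t) (Ne.symm hvt)
  have hp := cs.geomRep_simpleRoot_nonneg (mt cs.isRightDescent_inv_iff.1 hus)
  have hq := cs.geomRep_simpleRoot_nonneg (mt cs.isRightDescent_inv_iff.1 hut)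
  have hsum : v = v s • simpleRoot s + v t • simpleRoot t := by
    ext k
    by_cases hks : k = s
    · subst hks; simp [simpleRoot_self, simpleRoot_of_ne hst]
    by_cases hkt : k = t
    · subst hkt; simp [simpleRoot_self, simpleRoot_of_ne hst.symm]
    · simp [hsupp k hks hkt, simpleRoot_of_ne hks, simpleRoot_of_ne hkt]
  -- The simple root z is a positive combination of two nonnegative vectors, so both are multiples
  -- of it. Being roots, both equal it, against s ≠ t.
  have hz : simpleRoot z =
      v s • cs.geomRep u⁻¹ (simpleRoot s) + v t • cs.geomRep u⁻¹ (simpleRoot t) := by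
    rw [← map_smul, ← map_smul, ← map_add, ← hsum, hv, geomRep_inv_apply_self]
  have hzero : ∀ k, k ≠ z →
      cs.geomRep u⁻¹ (simpleRoot s) k = 0 ∧ cs.geomRep u⁻¹ (simpleRoot t) k = 0 := by
    intro k hk
    have h1 := congrFun hz k
    have h2 := hp k
    have h3 := hq k
    rw [simpleRoot_of_ne hk] at h1
    simp only [Pi.add_apply, Pi.smul_apply, smul_eq_mul, Pi.zero_apply] at h1 h2 h3
    have h4 := mul_nonneg hvs'.le h2
    have h5 := mul_nonneg hvt'.le h3
    have h6 : v s * cs.geomRep u⁻¹ (simpleRoot s) k = 0 := by linarith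
    have h7 : v t * cs.geomRep u⁻¹ (simpleRoot t) k = 0 := by linarith
    exact ⟨(mul_eq_zero.1 h6).resolve_left hvs, (mul_eq_zero.1 h7).resolve_left hvt⟩
  have h1 := cs.eq_simpleRoot_of_eq_smul (hp z) (eq_smul_simpleRoot fun k hk => (hzero k hk).1)
  have h2 := cs.eq_simpleRoot_of_eq_smul (hq z) (eq_smul_simpleRoot fun k hk => (hzero k hk).2)
  exact hst (simpleRoot_injective ((cs.geomRep u⁻¹).injective (h1.trans h2.symm)))

/-- Unless both `s` and `t` fix the coset of `u`, the dihedral orbit of `u` has an element that is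
minimal on both sides and whose coset is not fixed by both `s` and `t`. -/
theorem exists_minimal_in_dihedral_orbit {u : W} (hu : u ∈ cs.minimalReps X)
    (h : ¬∃ x ∈ X, ∃ y ∈ X, cs.simple s * u = u * cs.simple x ∧ cs.simple t * u = u * cs.simple y) :
    ∃ d ∈ Subgroup.closure {cs.simple s, cs.simple t}, d * u ∈ cs.minimalReps X ∧
      ¬cs.IsLeftDescent (d * u) s ∧ ¬cs.IsLeftDescent (d * u) t ∧
      ¬∃ x ∈ X, ∃ y ∈ X, cs.simple s * (d * u) = d * u * cs.simple x ∧
        cs.simple t * (d * u) = d * u * cs.simple y := by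
  induction hn : cs.length u using Nat.strong_induction_on generalizing u with
  | _ n ih =>
  subst hn
  by_cases hdesc : ∃ r, (r = s ∨ r = t) ∧ cs.IsLeftDescent u r
  · obtain ⟨r, hr, hrd⟩ := hdesc
    -- If ru = uz with r a left descent, then z ∈ X would be a right descent of u.
    have hloop : ¬∃ z ∈ X, cs.simple r * u = u * cs.simple z := by
      rintro ⟨z, hz, he⟩
      refine hu z hz ?_
      rw [IsRightDescent, ← he]
      exact hrd
    have hloop' := cs.not_exists_simple_mul hloop
    obtain ⟨d, hd, h1, h2, h3, h4⟩ := ih _ hrd (cs.simple_mul_mem_minimalReps hu hloop) (by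
      rintro ⟨x, hx, y, hy, hsx, hty⟩
      rcases hr with rfl | rfl
      · exact hloop' ⟨x, hx, hsx⟩
      · exact hloop' ⟨y, hy, hty⟩) rfl
    rw [show d * (cs.simple r * u) = d * cs.simple r * u from (mul_assoc _ _ _).symm]
      at h1 h2 h3 h4
    exact ⟨d * cs.simple r, mul_mem hd (cs.simple_mem_closure hr), h1, h2, h3, h4⟩
  · refine ⟨1, one_mem _, ?_⟩
    rw [one_mul]
    exact ⟨hu, fun h' => hdesc ⟨s, Or.inl rfl, h'⟩, fun h' => hdesc ⟨t, Or.inr rfl, h'⟩, h⟩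

/-- Unless both `s` and `t` fix the coset of `u`, all the cosets in the dihedral orbit of `u` are
fixed by virtue of the same element of `X`. -/
theorem eq_of_fixed_in_dihedral_orbit (hst : s ≠ t) {u : W} (hu : u ∈ cs.minimalReps X)
    (h : ¬∃ x ∈ X, ∃ y ∈ X, cs.simple s * u = u * cs.simple x ∧ cs.simple t * u = u * cs.simple y)
    {d₁ d₂ : W} (hd₁ : d₁ ∈ Subgroup.closure {cs.simple s, cs.simple t})
    (hd₂ : d₂ ∈ Subgroup.closure {cs.simple s, cs.simple t})
    (hm₁ : d₁ * u ∈ cs.minimalReps X) (hm₂ : d₂ * u ∈ cs.minimalReps X)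
    {r₁ r₂ z₁ z₂ : B} (hr₁ : r₁ = s ∨ r₁ = t) (hr₂ : r₂ = s ∨ r₂ = t) (hz₁ : z₁ ∈ X) (hz₂ : z₂ ∈ X)
    (h₁ : cs.simple r₁ * (d₁ * u) = d₁ * u * cs.simple z₁)
    (h₂ : cs.simple r₂ * (d₂ * u) = d₂ * u * cs.simple z₂) : z₁ = z₂ := by
  obtain ⟨d, hd, hm, hs, ht, hno⟩ := cs.exists_minimal_in_dihedral_orbit hu h
  have key : ∀ {d' : W} {r z : B}, d' ∈ Subgroup.closure {cs.simple s, cs.simple t} →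
      d' * u ∈ cs.minimalReps X → (r = s ∨ r = t) → z ∈ X →
      cs.simple r * (d' * u) = d' * u * cs.simple z →
      cs.simple s * (d * u) = d * u * cs.simple z ∨
        cs.simple t * (d * u) = d * u * cs.simple z := by
    intro d' r z hd' hm' hr hz he
    have e : d' * u = d' * d⁻¹ * (d * u) := by group
    rw [e] at he hm'
    exact cs.simple_mul_eq_or_of_minimal hst (mul_mem hd' (inv_mem hd)) hs ht hr (hm z hz)
      (hm' z hz) he
  -- Both z₁ and z₂ are seen at the minimal element du. They cannot come from different letters
  -- there, since s and t do not both fix its coset.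
  rcases key hd₁ hm₁ hr₁ hz₁ h₁ with k₁ | k₁ <;> rcases key hd₂ hm₂ hr₂ hz₂ h₂ with k₂ | k₂
  · exact cs.eq_of_simple_mul_eq k₁ k₂
  · exact (hno ⟨z₁, hz₁, z₂, hz₂, k₁, k₂⟩).elim
  · exact (hno ⟨z₂, hz₂, z₁, hz₁, k₂, k₁⟩).elim
  · exact cs.eq_of_simple_mul_eq k₁ k₂

/-- If `u` conjugates the pair `x, y` to the pair `s, t`, the corresponding entries of the Coxeter
matrix are equal. -/
theorem coxeterMatrix_eq_of_simple_mul_eq {u : W} {x y : B} (hx : ¬cs.IsRightDescent u x)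
    (hy : ¬cs.IsRightDescent u y) (hsx : cs.simple s * u = u * cs.simple x)
    (hty : cs.simple t * u = u * cs.simple y) : M x y = M s t := by
  rw [cs.simple_mul_eq_mul_simple_iff hx] at hsx
  rw [cs.simple_mul_eq_mul_simple_iff hy] at hty
  have h := cs.geomForm_geomRep u (simpleRoot x) (simpleRoot y)
  rw [hsx, hty, geomForm_simpleRoot, geomForm_simpleRoot, neg_inj] at h
  have hmem : ∀ n : ℕ, Real.pi / n ∈ Set.Icc 0 Real.pi := by
    intro n
    refine ⟨by positivity, ?_⟩
    rcases Nat.eq_zero_or_pos n with rfl | hn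
    · simp [Real.pi_pos.le]
    · exact div_le_self Real.pi_pos.le (by exact_mod_cast hn)
  have := Real.injOn_cos (hmem _) (hmem _) h
  rw [div_eq_mul_inv, div_eq_mul_inv] at this
  have := inv_injective (mul_left_cancel₀ Real.pi_ne_zero this)
  exact_mod_cast this.symm

end Dihedral

end CoxeterSystem

/-! ### The cocycle on cosets and its braid relations. -/

namespace CoxeterSystem

open CoxeterMatrix

section Cocycle

variable {B W H : Type*} [Fintype B] [DecidableEq B] [Group W] {M : CoxeterMatrix B}
  (cs : CoxeterSystem M W) [Group H] (X : Set B) (h : B → H)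

open Classical in
/-- The transformation of `minimalReps X × H` attached to a generator `s`: it multiplies the
minimal representative by `s` if this changes its coset, and otherwise multiplies the second
component by the element of `H` attached to the conjugate generator. -/
noncomputable def cocycleStep (s : B) (p : cs.minimalReps X × H) : cs.minimalReps X × H :=
  if hz : ∃ z ∈ X, cs.simple s * p.1 = p.1 * cs.simple z then (p.1, h hz.choose * p.2)
  else (⟨cs.simple s * p.1, cs.simple_mul_mem_minimalReps p.1.2 hz⟩, p.2)

variable {X}

theorem cocycleStep_of_eq {s z : B} {u : cs.minimalReps X} (hz : z ∈ X)
    (e : cs.simple s * u = u * cs.simple z) (a : H) :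
    cs.cocycleStep X h s (u, a) = (u, h z * a) := by
  have hex : ∃ z ∈ X, cs.simple s * (u : W) = u * cs.simple z := ⟨z, hz, e⟩
  rw [cocycleStep, dif_pos hex, cs.eq_of_simple_mul_eq hex.choose_spec.2 e]

theorem cocycleStep_of_not_exists {s : B} {u : cs.minimalReps X}
    (e : ¬∃ z ∈ X, cs.simple s * (u : W) = u * cs.simple z) (a : H) :
    cs.cocycleStep X h s (u, a) = (⟨cs.simple s * u, cs.simple_mul_mem_minimalReps u.2 e⟩, a) := by
  rw [cocycleStep, dif_neg e]

theorem cocycleStep_cocycleStep {h h' : B → H} (hh : ∀ z, h z * h' z = 1) (s : B)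
    (p : cs.minimalReps X × H) : cs.cocycleStep X h s (cs.cocycleStep X h' s p) = p := by
  obtain ⟨u, a⟩ := p
  by_cases e : ∃ z ∈ X, cs.simple s * (u : W) = u * cs.simple z
  · obtain ⟨z, hz, e⟩ := e
    rw [cs.cocycleStep_of_eq h' hz e, cs.cocycleStep_of_eq h hz e, ← mul_assoc, hh, one_mul]
  · rw [cs.cocycleStep_of_not_exists h' e, cs.cocycleStep_of_not_exists h]
    · simp
    · exact cs.not_exists_simple_mul e

theorem cocycleStep_mul_right (s : B) (u : cs.minimalReps X) (a b : H) :
    cs.cocycleStep X h s (u, a * b) =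
      ((cs.cocycleStep X h s (u, a)).1, (cs.cocycleStep X h s (u, a)).2 * b) := by
  by_cases e : ∃ z ∈ X, cs.simple s * (u : W) = u * cs.simple z
  · obtain ⟨z, hz, e⟩ := e
    rw [cs.cocycleStep_of_eq h hz e, cs.cocycleStep_of_eq h hz e, mul_assoc]
  · rw [cs.cocycleStep_of_not_exists h e, cs.cocycleStep_of_not_exists h e]

variable (X) in
/-- `cocycleStep` as a permutation. -/
noncomputable def cocyclePerm (s : B) : Equiv.Perm (cs.minimalReps X × H) where
  toFun := cs.cocycleStep X h s
  invFun := cs.cocycleStep X (fun z => (h z)⁻¹) s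
  left_inv := cs.cocycleStep_cocycleStep (fun z => inv_mul_cancel (h z)) s
  right_inv := cs.cocycleStep_cocycleStep (fun z => mul_inv_cancel (h z)) s

theorem cocyclePerm_apply (s : B) (p : cs.minimalReps X × H) :
    cs.cocyclePerm X h s p = cs.cocycleStep X h s p := rfl

theorem alternatingProd_cocyclePerm_of_fixed {s t x y : B} {u : cs.minimalReps X} (hx : x ∈ X)
    (hy : y ∈ X) (hsx : cs.simple s * u = u * cs.simple x) (hty : cs.simple t * u = u * cs.simple y)
    (n : ℕ) (a : H) :
    alternatingProd (cs.cocyclePerm X h s) (cs.cocyclePerm X h t) n (u, a) =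
      (u, alternatingProd (h x) (h y) n * a) := by
  induction n generalizing s t x y with
  | zero => simp [alternatingProd]
  | succ n ih =>
    rw [alternatingProd, Equiv.Perm.mul_apply, ih hy hx hty hsx, cocyclePerm_apply,
      cs.cocycleStep_of_eq h hx hsx, alternatingProd, mul_assoc]

/-- If only `x` occurs as a fixing element along a walk, the walk contributes the power of `h x`
whose exponent counts the occurrences of a reflection in an inversion sequence. -/
theorem prod_cocyclePerm_apply {x s t : B} (hx : x ∈ X) (u : cs.minimalReps X)
    (hu : ∀ d ∈ Subgroup.closure {cs.simple s, cs.simple t}, d * (u : W) ∈ cs.minimalReps X →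
      ∀ r, (r = s ∨ r = t) → ∀ z ∈ X, cs.simple r * (d * u) = d * u * cs.simple z → z = x)
    (ω : List B) (hω : ∀ r ∈ ω, r = s ∨ r = t) (a : H) [DecidableEq W] :
    ((ω.map (cs.cocyclePerm X h)).prod (u, a)).2 = h x ^ ((cs.leftInvSeq ω).count
        (cs.wordProd ω * u * cs.simple x * (cs.wordProd ω * u)⁻¹)) * a ∧
    (((ω.map (cs.cocyclePerm X h)).prod (u, a)).1 : W) = cs.wordProd ω * u *
      cs.simple x ^ ((cs.leftInvSeq ω).count
        (cs.wordProd ω * u * cs.simple x * (cs.wordProd ω * u)⁻¹)) ∧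
    ∃ d ∈ Subgroup.closure {cs.simple s, cs.simple t},
      (((ω.map (cs.cocyclePerm X h)).prod (u, a)).1 : W) = d * u := by
  induction ω with
  | nil => exact ⟨by simp, by simp, 1, one_mem _, by simp⟩
  | cons r ω ih =>
    obtain ⟨h2, h1, d, hd, hdu⟩ := ih fun r' hr' => hω r' (List.mem_cons_of_mem _ hr')
    have hr := hω r List.mem_cons_self
    have hcount : ∀ g : W, (cs.leftInvSeq (r :: ω)).count
        (cs.simple r * g * cs.simple x * (cs.simple r * g)⁻¹) =
        (cs.leftInvSeq ω).count (g * cs.simple x * g⁻¹) +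
          if cs.simple r * g = g * cs.simple x then 1 else 0 := by
      intro g
      have e : cs.simple r * g * cs.simple x * (cs.simple r * g)⁻¹ =
          MulAut.conj (cs.simple r) (g * cs.simple x * g⁻¹) := by
        rw [MulAut.conj_apply]; group
      rw [leftInvSeq, List.count_cons, e,
        List.count_map_of_injective _ _ (MulAut.conj (cs.simple r)).injective]
      congr 1
      refine if_congr ?_ rfl rfl
      rw [beq_iff_eq, MulAut.conj_apply, eq_mul_inv_iff_mul_eq, mul_left_cancel_iff,
        eq_mul_inv_iff_mul_eq]
    have hc := hcount (cs.wordProd ω * u)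
    rw [List.map_cons, List.prod_cons, Equiv.Perm.mul_apply, cocyclePerm_apply, wordProd_cons,
      mul_assoc (cs.simple r), hc]
    set q := (ω.map (cs.cocyclePerm X h)).prod (u, a)
    set g := cs.wordProd ω * (u : W)
    set k := (cs.leftInvSeq ω).count (g * cs.simple x * g⁻¹)
    clear_value g
    -- The first component of q is g times a power of x, which commutes with x, so the test for a
    -- fixed coset can be made on g. There it says that the new entry of the inversion sequence is
    -- the counted reflection.
    have hiff : (∃ z ∈ X, cs.simple r * (q.1 : W) = q.1 * cs.simple z) ↔
        cs.simple r * g = g * cs.simple x := by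
      have hx' : cs.simple r * (q.1 : W) = q.1 * cs.simple x ↔
          cs.simple r * g = g * cs.simple x := by
        rw [h1, mul_assoc g, ← pow_succ, pow_succ', ← mul_assoc, ← mul_assoc, mul_left_inj]
      rw [← hx']
      refine ⟨?_, fun e => ⟨x, hx, e⟩⟩
      rintro ⟨z, hz, e⟩
      obtain rfl : z = x := by
        refine hu d hd ?_ r hr z hz ?_
        · rw [← hdu]; exact q.1.2
        · rw [← hdu]; exact e
      exact e
    by_cases e : cs.simple r * g = g * cs.simple x
    · have e' : cs.simple r * (q.1 : W) = q.1 * cs.simple x := by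
        rw [h1, mul_assoc g, ← pow_succ, pow_succ', ← mul_assoc, ← mul_assoc, e]
      have hstep : cs.cocycleStep X h r q = (q.1, h x * q.2) := cs.cocycleStep_of_eq h hx e' q.2
      rw [hstep, if_pos e]
      refine ⟨?_, ?_, d, hd, hdu⟩
      · rw [h2, pow_succ', mul_assoc]
      · rw [h1, e, pow_succ', ← mul_assoc, mul_assoc g, cs.simple_mul_simple_self, mul_one]
    · have hstep := cs.cocycleStep_of_not_exists h (mt hiff.1 e) q.2
      change cs.cocycleStep X h r q = _ at hstep
      rw [hstep, if_neg e]
      refine ⟨h2, ?_, cs.simple r * d, mul_mem (cs.simple_mem_closure hr) hd, ?_⟩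
      · simp only [h1, mul_assoc, add_zero]
      · simp only [hdu, mul_assoc]

/-- For empty X no coset is fixed, and `prod_cocyclePerm_apply` has no x to start from. -/
theorem prod_cocyclePerm_empty_apply (ω : List B) (u : cs.minimalReps ∅) (a : H) :
    ((ω.map (cs.cocyclePerm ∅ h)).prod (u, a)).2 = a ∧
    (((ω.map (cs.cocyclePerm ∅ h)).prod (u, a)).1 : W) = cs.wordProd ω * u := by
  induction ω with
  | nil => simp
  | cons r ω ih =>
    rw [List.map_cons, List.prod_cons, Equiv.Perm.mul_apply, cocyclePerm_apply, wordProd_cons]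
    set q := (ω.map (cs.cocyclePerm ∅ h)).prod (u, a)
    have hstep := cs.cocycleStep_of_not_exists (X := ∅) (s := r) (u := q.1) h (by simp) q.2
    change cs.cocycleStep ∅ h r q = _ at hstep
    rw [hstep]
    refine ⟨ih.1, ?_⟩
    simp only [ih.2, mul_assoc]

/-- The permutations `cocyclePerm` satisfy the braid relations. -/
theorem alternatingProd_cocyclePerm (hh : ∀ x ∈ X, ∀ y ∈ X, M x y ≠ 0 →
      alternatingProd (h x) (h y) (M x y) = alternatingProd (h y) (h x) (M x y))
    {s t : B} (hst : s ≠ t) (hM : M s t ≠ 0) :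
    alternatingProd (cs.cocyclePerm X h s) (cs.cocyclePerm X h t) (M s t) =
      alternatingProd (cs.cocyclePerm X h t) (cs.cocyclePerm X h s) (M s t) := by
  classical
  ext1 ⟨u, a⟩
  by_cases hdl : ∃ x ∈ X, ∃ y ∈ X,
      cs.simple s * (u : W) = u * cs.simple x ∧ cs.simple t * (u : W) = u * cs.simple y
  · obtain ⟨x, hx, y, hy, hsx, hty⟩ := hdl
    rw [cs.alternatingProd_cocyclePerm_of_fixed h hx hy hsx hty,
      cs.alternatingProd_cocyclePerm_of_fixed h hy hx hty hsx]
    have e := cs.coxeterMatrix_eq_of_simple_mul_eq (u.2 x hx) (u.2 y hy) hsx hty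
    rw [← e, hh x hx y hy (e ▸ hM)]
  rw [alternatingProd_eq_prod_map (cs.cocyclePerm X h),
    alternatingProd_eq_prod_map (cs.cocyclePerm X h)]
  rcases X.eq_empty_or_nonempty with rfl | ⟨x₀, hx₀⟩
  · obtain ⟨h1, h2⟩ := cs.prod_cocyclePerm_empty_apply h (alternatingWord t s (M s t)).reverse u a
    obtain ⟨h3, h4⟩ := cs.prod_cocyclePerm_empty_apply h (alternatingWord s t (M s t)).reverse u a
    refine Prod.ext (Subtype.ext ?_) (h1.trans h3.symm)
    rw [h2, h4, wordProd_reverse_braidWord_eq]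
  -- If the orbit contains no fixed coset, any element of X will do.
  obtain ⟨x, hx, hux⟩ : ∃ x ∈ X, ∀ d ∈ Subgroup.closure {cs.simple s, cs.simple t},
      d * (u : W) ∈ cs.minimalReps X → ∀ r, (r = s ∨ r = t) → ∀ z ∈ X,
        cs.simple r * (d * u) = d * u * cs.simple z → z = x := by
    by_cases hloop : ∃ d ∈ Subgroup.closure {cs.simple s, cs.simple t},
        d * (u : W) ∈ cs.minimalReps X ∧ ∃ r, (r = s ∨ r = t) ∧ ∃ z ∈ X,
          cs.simple r * (d * u) = d * u * cs.simple z
    · obtain ⟨d, hd, hm, r, hr, z, hz, e⟩ := hloop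
      refine ⟨z, hz, fun d' hd' hm' r' hr' z' hz' e' => ?_⟩
      exact cs.eq_of_fixed_in_dihedral_orbit hst u.2 hdl hd' hd hm' hm hr' hr hz' hz e' e
    · exact ⟨x₀, hx₀, fun d hd hm r hr z hz e => (hloop ⟨d, hd, hm, r, hr, z, hz, e⟩).elim⟩
  have hmem : ∀ (i j : B) (n : ℕ), (i = s ∨ i = t) → (j = s ∨ j = t) →
      ∀ r ∈ (alternatingWord i j n).reverse, r = s ∨ r = t := by
    intro i j n hi hj r hr
    rw [List.mem_reverse] at hr
    induction n generalizing i j with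
    | zero => simp [alternatingWord] at hr
    | succ n ih =>
      rw [alternatingWord_succ, List.concat_eq_append, List.mem_append, List.mem_singleton] at hr
      rcases hr with hr | rfl
      · exact ih j i hj hi hr
      · exact hj
  obtain ⟨h1, h2, -⟩ := cs.prod_cocyclePerm_apply h hx u hux _
    (hmem t s (M s t) (Or.inr rfl) (Or.inl rfl)) a
  obtain ⟨h3, h4, -⟩ := cs.prod_cocyclePerm_apply h hx u hux _
    (hmem s t (M s t) (Or.inl rfl) (Or.inr rfl)) a
  rw [wordProd_reverse_braidWord_eq, (cs.leftInvSeq_braidWord_perm s t).count_eq] at h1 h2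
  exact Prod.ext (Subtype.ext (h2.trans h4.symm)) (h1.trans h3.symm)

end Cocycle

end CoxeterSystem

/-! ### The action of the Artin group. -/

namespace ArtinGroup

variable {V : Type*} (Γ : SimpleGraph V) (m : Γ.edgeSet → {n : ℕ // 2 ≤ n})

open Classical in
/-- The Coxeter matrix of a labelled graph, with the entry `0` (for `∞`) at non-adjacent pairs. -/
noncomputable def coxeterMatrix : CoxeterMatrix V where
  M := Matrix.of fun x y => if x = y then 1 else if h : Γ.Adj x y then (m ⟨s(x, y), h⟩ : ℕ) else 0
  isSymm := by
    ext x y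
    simp only [Matrix.transpose_apply, Matrix.of_apply]
    by_cases hxy : x = y
    · simp [hxy]
    · by_cases h : Γ.Adj x y
      · simp [hxy, Ne.symm hxy, h, h.symm, Sym2.eq_swap]
      · have h' : ¬Γ.Adj y x := fun h' => h h'.symm
        simp [hxy, Ne.symm hxy, h, h']
  diagonal x := by simp
  off_diagonal x y hxy := by
    simp only [Matrix.of_apply, if_neg hxy]
    split_ifs with h
    · have := (m ⟨s(x, y), h⟩).2
      omega
    · simp

theorem coxeterMatrix_of_adj {x y : V} (h : Γ.Adj x y) :
    coxeterMatrix Γ m x y = (m ⟨s(x, y), h⟩ : ℕ) := by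
  simp [coxeterMatrix, h.ne, h]

theorem adj_of_coxeterMatrix_ne_zero {x y : V} (hxy : x ≠ y) (h : coxeterMatrix Γ m x y ≠ 0) :
    Γ.Adj x y := by
  by_contra hadj
  exact h (by simp [coxeterMatrix, hxy, hadj])

theorem map_alternatingProd {G G' : Type*} [Monoid G] [Monoid G'] (f : G →* G') (a b : G)
    (n : ℕ) : f (alternatingProd a b n) = alternatingProd (f a) (f b) n := by
  induction n generalizing a b with
  | zero => simp [alternatingProd]
  | succ n ih => rw [alternatingProd, map_mul, ih, alternatingProd]

variable {Γ m} in
theorem lift_eq_one_of_mem_artinRelators {G : Type*} [Group G] {f : V → G}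
    (hf : ∀ (x y : V) (h : Γ.Adj x y), alternatingProd (f x) (f y) (m ⟨s(x, y), h⟩ : ℕ) =
      alternatingProd (f y) (f x) (m ⟨s(x, y), h⟩ : ℕ)) :
    ∀ r ∈ artinRelators Γ m, FreeGroup.lift f r = 1 := by
  rintro r ⟨x, y, h, rfl⟩
  rw [map_mul, map_inv, map_alternatingProd, map_alternatingProd, FreeGroup.lift_apply_of,
    FreeGroup.lift_apply_of, hf x y h, mul_inv_cancel]

theorem alternatingProd_sigma {x y : V} (h : Γ.Adj x y) :
    alternatingProd (sigma Γ m x) (sigma Γ m y) (m ⟨s(x, y), h⟩ : ℕ) =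
      alternatingProd (sigma Γ m y) (sigma Γ m x) (m ⟨s(x, y), h⟩ : ℕ) := by
  have h1 : PresentedGroup.mk (artinRelators Γ m)
      (alternatingProd (FreeGroup.of x) (FreeGroup.of y) (m ⟨s(x, y), h⟩ : ℕ) *
      (alternatingProd (FreeGroup.of y) (FreeGroup.of x) (m ⟨s(x, y), h⟩ : ℕ))⁻¹) = 1 :=
    PresentedGroup.one_of_mem ⟨x, y, h, rfl⟩
  rw [map_mul, map_inv, map_alternatingProd, map_alternatingProd, mul_inv_eq_one] at h1
  exact h1

theorem closure_range_sigma : Subgroup.closure (Set.range (sigma Γ m)) = ⊤ :=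
  PresentedGroup.closure_range_of _

theorem sigma_mem_standardParabolic {X : Set V} {x : V} (hx : x ∈ X) :
    sigma Γ m x ∈ standardParabolic Γ m X :=
  Subgroup.subset_closure ⟨x, hx, rfl⟩

theorem conjSubgroup_conjSubgroup {G : Type*} [Group G] (g h : G) (H : Subgroup G) :
    conjSubgroup g (conjSubgroup h H) = conjSubgroup (g * h) H := by
  rw [conjSubgroup, conjSubgroup, conjSubgroup, Subgroup.map_map, map_mul]
  rfl

theorem conjSubgroup_one {G : Type*} [Group G] (H : Subgroup G) : conjSubgroup 1 H = H := by
  ext x; simp [conjSubgroup]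

theorem conjSubgroup_mono {G : Type*} [Group G] (g : G) {H K : Subgroup G} (h : H ≤ K) :
    conjSubgroup g H ≤ conjSubgroup g K :=
  Subgroup.map_mono h

theorem mem_conjSubgroup {G : Type*} [Group G] {g x : G} {H : Subgroup G} (hx : x ∈ H) :
    g * x * g⁻¹ ∈ conjSubgroup g H :=
  ⟨x, hx, rfl⟩

theorem conjSubgroup_closure {G : Type*} [Group G] (g : G) (S : Set G) :
    conjSubgroup g (Subgroup.closure S) = Subgroup.closure ((fun x => g * x * g⁻¹) '' S) := by
  rw [conjSubgroup, MonoidHom.map_closure]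
  rfl

section Action

open Classical in
/-- The element of `A_X` attached to a vertex: the standard generator if the vertex is in `X`. -/
noncomputable def sigmaIn (X : Set V) (x : V) : standardParabolic Γ m X :=
  -- The value 1 outside X is never used: the action evaluates this only at elements of X.
  if hx : x ∈ X then ⟨sigma Γ m x, sigma_mem_standardParabolic Γ m hx⟩ else 1

theorem coe_sigmaIn {X : Set V} {x : V} (hx : x ∈ X) :
    (sigmaIn Γ m X x : ArtinGroup Γ m) = sigma Γ m x := by
  rw [sigmaIn, dif_pos hx]

theorem alternatingProd_sigmaIn {X : Set V} {x y : V} (hx : x ∈ X) (hy : y ∈ X)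
    (h : coxeterMatrix Γ m x y ≠ 0) :
    alternatingProd (sigmaIn Γ m X x) (sigmaIn Γ m X y) (coxeterMatrix Γ m x y) =
      alternatingProd (sigmaIn Γ m X y) (sigmaIn Γ m X x) (coxeterMatrix Γ m x y) := by
  by_cases hxy : x = y
  · rw [hxy]
  have hadj := adj_of_coxeterMatrix_ne_zero Γ m hxy h
  apply (standardParabolic Γ m X).subtype_injective
  rw [map_alternatingProd, map_alternatingProd, Subgroup.subtype_apply, Subgroup.subtype_apply,
    coe_sigmaIn Γ m hx, coe_sigmaIn Γ m hy, coxeterMatrix_of_adj Γ m hadj,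
    alternatingProd_sigma Γ m hadj]

variable [Fintype V] [DecidableEq V]

/-- The action of the Artin group on pairs of a minimal coset representative in the Coxeter group
and an element of a standard parabolic subgroup. -/
noncomputable def cosetAction (X : Set V) : ArtinGroup Γ m →* Equiv.Perm
    ((coxeterMatrix Γ m).toCoxeterSystem.minimalReps X × standardParabolic Γ m X) :=
  PresentedGroup.toGroup (f := (coxeterMatrix Γ m).toCoxeterSystem.cocyclePerm X (sigmaIn Γ m X))
    (lift_eq_one_of_mem_artinRelators fun x y h => by
      have hM := coxeterMatrix_of_adj Γ m h
      rw [← hM]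
      refine (coxeterMatrix Γ m).toCoxeterSystem.alternatingProd_cocyclePerm (sigmaIn Γ m X)
        (fun x hx y hy => alternatingProd_sigmaIn Γ m hx hy) h.ne ?_
      rw [hM]
      have := (m ⟨s(x, y), h⟩).2
      omega)

theorem cosetAction_sigma (X : Set V) (x : V)
    (p : (coxeterMatrix Γ m).toCoxeterSystem.minimalReps X × standardParabolic Γ m X) :
    cosetAction Γ m X (sigma Γ m x) p =
      (coxeterMatrix Γ m).toCoxeterSystem.cocycleStep X (sigmaIn Γ m X) x p := by
  rw [cosetAction, sigma, PresentedGroup.toGroup.of, CoxeterSystem.cocyclePerm_apply]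

/-- With `cosetAction_one_of_mem`, this turns the action of α⁻¹β on (1, 1) into right translation by
β. -/
theorem cosetAction_mul_right {X : Set V} (g : ArtinGroup Γ m)
    (u : (coxeterMatrix Γ m).toCoxeterSystem.minimalReps X) (a b : standardParabolic Γ m X) :
    cosetAction Γ m X g (u, a * b) =
      ((cosetAction Γ m X g (u, a)).1, (cosetAction Γ m X g (u, a)).2 * b) := by
  have hg : g ∈ Subgroup.closure (Set.range (sigma Γ m)) := by
    rw [closure_range_sigma]; exact Subgroup.mem_top g
  induction hg using Subgroup.closure_induction generalizing u a with
  | mem g hg =>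
    obtain ⟨x, rfl⟩ := hg
    rw [cosetAction_sigma, cosetAction_sigma, CoxeterSystem.cocycleStep_mul_right]
  | one => simp
  | mul g g' _ _ h h' =>
    rw [map_mul, Equiv.Perm.mul_apply, Equiv.Perm.mul_apply, h', h]
  | inv g _ h =>
    rw [map_inv, Equiv.Perm.inv_eq_iff_eq, h]
    simp

/-- A standard parabolic subgroup fixes the trivial coset and acts by left multiplication. -/
theorem cosetAction_one_of_mem {X : Set V} (g b : standardParabolic Γ m X) :
    cosetAction Γ m X g (⟨1, CoxeterSystem.one_mem_minimalReps _ X⟩, b) =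
      (⟨1, CoxeterSystem.one_mem_minimalReps _ X⟩, g * b) := by
  obtain ⟨g, hg⟩ := g
  have hg' : g ∈ Subgroup.closure (sigma Γ m '' X) := hg
  induction hg' using Subgroup.closure_induction generalizing b with
  | mem g hg' =>
    obtain ⟨x, hx, rfl⟩ := hg'
    rw [cosetAction_sigma, CoxeterSystem.cocycleStep_of_eq _ _ hx (by simp)]
    congr 2
    exact Subtype.ext (coe_sigmaIn Γ m hx)
  | one => simp
  | mul g g' hg₁ hg₂ h h' =>
    rw [map_mul, Equiv.Perm.mul_apply, h' b hg₂, h _ hg₁, ← mul_assoc]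
    rfl
  | inv g hg₁ h =>
    rw [map_inv, Equiv.Perm.inv_eq_iff_eq, h _ hg₁, ← mul_assoc,
      show (⟨g, hg₁⟩ * ⟨g⁻¹, hg⟩ : standardParabolic Γ m X) = 1 from Subtype.ext (mul_inv_cancel g),
      one_mul]

end Action

/-- A conjugate of `A_Y` that lies in `A_X` is conjugate in `A_X` to some `A_{Y'}` with
`Y' ⊆ X`. -/
theorem exists_conjSubgroup_eq_of_le [Finite V] {X Y : Set V} {α : ArtinGroup Γ m}
    (h : conjSubgroup α (standardParabolic Γ m Y) ≤ standardParabolic Γ m X) :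
    ∃ Y' : Set V, Y' ⊆ X ∧ ∃ γ ∈ standardParabolic Γ m X,
      conjSubgroup α (standardParabolic Γ m Y) = conjSubgroup γ (standardParabolic Γ m Y') := by
  classical
  have := Fintype.ofFinite V
  set o : (coxeterMatrix Γ m).toCoxeterSystem.minimalReps X × standardParabolic Γ m X :=
    (⟨1, CoxeterSystem.one_mem_minimalReps _ X⟩, 1) with ho
  set p := cosetAction Γ m X α⁻¹ o with hp
  have key : ∀ y ∈ Y, ∃ z ∈ X, α * sigma Γ m y * α⁻¹ =
      (p.2 : ArtinGroup Γ m)⁻¹ * sigma Γ m z * p.2 := by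
    intro y hy
    have hβ := h (mem_conjSubgroup (g := α) (sigma_mem_standardParabolic Γ m hy))
    set β : standardParabolic Γ m X := ⟨α * sigma Γ m y * α⁻¹, hβ⟩ with hβdef
    have h1 : cosetAction Γ m X (sigma Γ m y) p = (p.1, p.2 * β) := by
      have e : sigma Γ m y * α⁻¹ = α⁻¹ * (β : ArtinGroup Γ m) := by
        rw [hβdef]; group
      rw [hp, ← Equiv.Perm.mul_apply, ← map_mul, e, map_mul, Equiv.Perm.mul_apply, ho,
        cosetAction_one_of_mem, mul_one, ← one_mul β, cosetAction_mul_right, one_mul]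
    rw [cosetAction_sigma] at h1
    by_cases hz : ∃ z ∈ X, (coxeterMatrix Γ m).toCoxeterSystem.simple y * p.1 =
        p.1 * (coxeterMatrix Γ m).toCoxeterSystem.simple z
    · obtain ⟨z, hz, e⟩ := hz
      have h2 := CoxeterSystem.cocycleStep_of_eq _ (sigmaIn Γ m X) hz e p.2
      have h3 := congrArg (fun q => (q.2 : ArtinGroup Γ m)) (h2.symm.trans h1)
      simp only [Subgroup.coe_mul, coe_sigmaIn Γ m hz] at h3
      exact ⟨z, hz, by rw [mul_assoc _ (sigma Γ m z), h3, inv_mul_cancel_left]⟩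
    -- The coset would move, yet the first component is unchanged: then y = 1 in W, against its
    -- length 1.
    · have h2 := CoxeterSystem.cocycleStep_of_not_exists _ (sigmaIn Γ m X) hz p.2
      have h3 := congrArg (fun q => (q.1 : (coxeterMatrix Γ m).Group)) (h2.symm.trans h1)
      have h4 := (coxeterMatrix Γ m).toCoxeterSystem.length_simple y
      rw [mul_eq_right.1 h3, CoxeterSystem.length_one] at h4
      exact absurd h4 zero_ne_one
  choose! f hf using key
  refine ⟨f '' Y, ?_, (p.2 : ArtinGroup Γ m)⁻¹, inv_mem p.2.2, ?_⟩
  · rintro _ ⟨y, hy, rfl⟩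
    exact (hf y hy).1
  · simp only [standardParabolic]
    rw [conjSubgroup_closure, conjSubgroup_closure,
      Set.image_image, Set.image_image, Set.image_image]
    congr 1
    refine Set.image_congr fun y hy => ?_
    rw [(hf y hy).2, inv_inv]

end ArtinGroup

theorem theorem1p1 {V : Type*} [Finite V] (Γ : SimpleGraph V)
    (m : Γ.edgeSet → {n : ℕ // 2 ≤ n}) :
    (∀ (X Y : Set V) (α : ArtinGroup Γ m),
      ArtinGroup.conjSubgroup α (ArtinGroup.standardParabolic Γ m Y) ≤
        ArtinGroup.standardParabolic Γ m X →
      ∃ Y' : Set V, Y' ⊆ X ∧ ∃ γ ∈ ArtinGroup.standardParabolic Γ m X,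
        ArtinGroup.conjSubgroup α (ArtinGroup.standardParabolic Γ m Y) =
          ArtinGroup.conjSubgroup γ (ArtinGroup.standardParabolic Γ m Y')) ∧
    (∀ (P : Subgroup (ArtinGroup Γ m)) (X : Set V) (β : ArtinGroup Γ m),
      ArtinGroup.IsParabolic Γ m P →
      P ≤ ArtinGroup.conjSubgroup β (ArtinGroup.standardParabolic Γ m X) →
      ArtinGroup.IsParabolicIn Γ m β X P) := by
  have key := fun (X Y : Set V) (α : ArtinGroup Γ m)
    (h : ArtinGroup.conjSubgroup α (ArtinGroup.standardParabolic Γ m Y) ≤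
      ArtinGroup.standardParabolic Γ m X) => ArtinGroup.exists_conjSubgroup_eq_of_le Γ m h
  refine ⟨key, ?_⟩
  rintro _ X β ⟨Y, g, rfl⟩ hle
  -- Conjugation by β⁻¹ reduces to the standard case; its conjugator γ is carried back to βγβ⁻¹.
  have h1 := ArtinGroup.conjSubgroup_mono β⁻¹ hle
  rw [ArtinGroup.conjSubgroup_conjSubgroup, ArtinGroup.conjSubgroup_conjSubgroup, inv_mul_cancel,
    ArtinGroup.conjSubgroup_one] at h1
  obtain ⟨Y', hY', γ, hγ, h2⟩ := key X Y (β⁻¹ * g) h1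
  refine ⟨Y', hY', β * γ * β⁻¹, ArtinGroup.mem_conjSubgroup hγ, ?_⟩
  have h3 := congrArg (ArtinGroup.conjSubgroup β) h2
  simp only [ArtinGroup.conjSubgroup_conjSubgroup, mul_inv_cancel_left] at h3
  rw [h3, ArtinGroup.conjSubgroup_conjSubgroup, inv_mul_cancel_right]
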